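/- A skew brace is a set $B$ with two binary operations such that $(B,+)$ and $(B,\ast)$ are groups (neither necessarily abelian) and $a\ast(b+c)=(a\ast b)+(-a)+(a\ast c)$ for all $a,b,c\in B$, where $-a$ is the inverse of $a$ under $+$; an isomorphism of skew braces is a bijection that respects both operations. For groups $M$, $A$ of the same finite order, let $b(M,A)$ be the number of isomorphism types of skew braces $(B,+,\ast)$ with $(B,\ast)\cong M$ and $(B,+)\cong A$. Let $n=pq$, where $p$ and $q$ are primes with $p\equiv 1\pmod q$. Then there are, up to isomorphism, exactly two groups of order $n$: the cyclic group $C_n$, and the nonabelian group $C_p\rtimes C_q$, the semidirect product for any nontrivial action of $C_q$ on $C_p$ (such actions exist, and all of them give isomorphic groups). The numbers $b(M,A)$ for groups $M$, $A$ of order $n$ are \[ \begin{array}{c|cc} & A\cong C_n & A\cong C_p\rtimes C_q\\ \hline M\cong C_n & 1 & 2\\ M\cong C_p\rtimes C_q & 1 & 2(q-1) \end{array} \] In particular, there are in total $2q+2$ skew braces of order $pq$ up to isomorphism. -/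

import Mathlib

universe u

/-- A skew (left) brace: a set with two group structures `(B, +)` (not necessarily commutative)
and `(B, *)` such that `a * (b + c) = a * b - a + a * c`. -/
class SkewBrace (B : Type u) extends AddGroup B, Group B where
  /-- The skew brace relation. -/
  mul_add_eq : ∀ a b c : B, a * (b + c) = a * b + -a + a * c

/-- A skew brace together with its underlying set. -/
structure BundledSkewBrace : Type (u + 1) where
  /-- The underlying set. -/
  carrier : Type u
  /-- The skew brace structure. -/
  [str : SkewBrace carrier]

namespace BundledSkewBrace

instance instSkewBrace (B : BundledSkewBrace.{u}) : SkewBrace B.carrier := B.str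

/-- Isomorphism of skew braces: there is a bijection respecting both operations.
Here `≃+*` is the type of bijections preserving `+` and `*`; no ring axioms are involved. -/
instance isoSetoid : Setoid BundledSkewBrace.{u} where
  r B B' := Nonempty (B.carrier ≃+* B'.carrier)
  iseqv :=
    { refl := fun B => ⟨RingEquiv.refl B.carrier⟩
      symm := fun ⟨e⟩ => ⟨e.symm⟩
      trans := fun ⟨e⟩ ⟨f⟩ => ⟨e.trans f⟩ }

/-- The number of isomorphism types of skew braces having the property `P`
(with value `0` if there are infinitely many). -/
noncomputable def numIsoTypes (P : BundledSkewBrace.{u} → Prop) : ℕ :=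
  Set.ncard {c : Quotient isoSetoid.{u} | ∃ B : BundledSkewBrace.{u}, P B ∧ Quotient.mk _ B = c}

/-- `b M A` is the number of isomorphism types of skew braces `(B, +, *)` with `(B, *) ≅ M` and
`(B, +) ≅ A`. The group `A` is written multiplicatively, so `(B, +)` is compared with it through
`Multiplicative`. -/
noncomputable def b (M A : Type u) [Group M] [Group A] : ℕ :=
  numIsoTypes fun B : BundledSkewBrace.{u} =>
    Nonempty (B.carrier ≃* M) ∧ Nonempty (Multiplicative B.carrier ≃* A)

/-- The number of isomorphism types of skew braces with exactly `n` elements, for `n > 0`. -/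
noncomputable def numOfOrder (n : ℕ) : ℕ :=
  numIsoTypes fun B : BundledSkewBrace.{u} => Nat.card B.carrier = n

end BundledSkewBrace

/-- The cyclic group of order `n` (for `n > 0`), written multiplicatively. -/
abbrev Cyc (n : ℕ) : Type := Multiplicative (ZMod n)

-- For a skew brace `B` of order `pq`, put `lam a b = -a + a * b`; this is an action of `(B, *)` on
-- `(B, +)` by automorphisms. As `p ≡ 1` mod `q`, the subgroup of order `p` consists of the elements
-- killed by `p`, so every `lam a` preserves it. Order considerations make `lam` trivial on the
-- quotient of order `q`, and make the kernel act trivially on itself, so `B` is an extension of the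
-- trivial brace on `ZMod q` by the trivial brace on `ZMod p` (`exists_extension`).
--
-- The key point is a dichotomy (`lam_incl_eq_self_or_incl_mul_eq_add`): the kernel acts trivially
-- under `lam` either in `B` or in the opposite brace, where addition is reversed and multiplication
-- kept. In the trivial case a lift `y` of a generator of the quotient can be chosen with `q • y =
-- 0` and `lam y y = y` (`exists_section`). Both operations then become semidirect products on the
-- same set `ZMod p × ZMod q`, given by characters `e (i * k)` and `e (j * k)` for one fixed
-- faithful `e`.
--
-- Rescaling the quotient multiplies `(i, j)` by a common unit. This leaves `(0, 0)` and `(0, 1)`,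
-- which equal their opposites, and `(1, j)` together with its opposite for each `j`. These `2 + 2q`
-- braces are pairwise non-isomorphic. Addition is commutative iff `i = 0`, multiplication iff `j =
-- 0`, and commutativity determines a group of order `pq`; sorting the list by these two properties
-- gives the table.

universe v

/-! ### Groups of order `pq`. -/

section Groups

theorem Nat.card_multiplicative (α : Type*) : Nat.card (Multiplicative α) = Nat.card α :=
  Nat.card_congr Multiplicative.toAdd

theorem lt_of_modEq_one {p q : ℕ} [Fact p.Prime] (hpq : p ≡ 1 [MOD q]) : q < p := by
  have hp := (Fact.out : p.Prime).one_lt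
  have h : q ∣ p - 1 := (Nat.modEq_iff_dvd' hp.le).1 hpq.symm
  have := Nat.le_of_dvd (by omega) h
  omega

/-- The kernel of a surjection from a group of order `pq` to `C_q` has order `p`. -/
theorem card_ker_of_surjective {p q : ℕ} [Fact q.Prime] {G : Type*} [Group G] (hG : Nat.card G = p * q)
    (π : G →* Multiplicative (ZMod q)) (hπ : Function.Surjective π) :
    Nat.card π.ker = p := by
  have h := π.ker.card_mul_index
  rw [Subgroup.index_ker, MonoidHom.range_eq_top.2 hπ, hG] at h
  simp only [Subgroup.card_top, Nat.card_multiplicative, Nat.card_zmod] at h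
  exact Nat.eq_of_mul_eq_mul_right (Fact.out : q.Prime).pos h

/-- Since `p ≡ 1` mod `q`, raising to the power `p` is the identity on `C_q`. The kernel is thus
described by the group structure alone, so every endomorphism preserves it. -/
theorem map_eq_one_iff_pow_eq_one {p q : ℕ} [Fact q.Prime] (hpq : p ≡ 1 [MOD q]) {G : Type*} [Group G]
    (hG : Nat.card G = p * q) (π : G →* Multiplicative (ZMod q)) (hπ : Function.Surjective π)
    (z : G) : π z = 1 ↔ z ^ p = 1 := by
  constructor
  · intro hz
    have h : (⟨z, hz⟩ : π.ker) ^ Nat.card π.ker = 1 := pow_card_eq_one'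
    rw [card_ker_of_surjective hG π hπ] at h
    simpa using congrArg Subtype.val h
  · intro hz
    have h : π z ^ p = 1 := by rw [← map_pow, hz, map_one]
    have h2 : Multiplicative.toAdd (π z ^ p) = Multiplicative.toAdd (π z) := by
      rw [toAdd_pow, nsmul_eq_mul, (ZMod.natCast_eq_natCast_iff p 1 q).2 hpq]
      simp
    rw [← Multiplicative.toAdd.injective h2, h]

theorem exists_surjective_of_card_eq_mul {p q : ℕ} [Fact p.Prime] [Fact q.Prime] (hpq : p ≡ 1 [MOD q]) {G : Type*} [Group G]
    (hG : Nat.card G = p * q) :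
    ∃ π : G →* Multiplicative (ZMod q), Function.Surjective π := by
  have hp : p.Prime := Fact.out
  have hq : q.Prime := Fact.out
  have hlt := lt_of_modEq_one hpq
  have : Finite G := Nat.finite_of_card_ne_zero (by rw [hG]; exact (Nat.mul_pos hp.pos hq.pos).ne')
  obtain ⟨g, hg⟩ := exists_prime_orderOf_dvd_card' (G := G) p (by rw [hG]; exact dvd_mul_right _ _)
  set H := Subgroup.zpowers g with hH
  have hHc : Nat.card H = p := by rw [hH, Nat.card_zpowers, hg]
  have hHi : H.index = q := by
    have h := H.card_mul_index
    rw [hHc, hG] at h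
    exact Nat.eq_of_mul_eq_mul_left hp.pos h
  -- A subgroup whose index is the smallest prime factor of the group order is normal.
  have hmin : (p * q).minFac = q := by
    apply le_antisymm (Nat.minFac_le_of_dvd hq.two_le (dvd_mul_left _ _))
    have hpr := Nat.minFac_prime (n := p * q) (by
      intro h; exact hq.one_lt.ne' (mul_eq_one.1 h).2)
    rcases hpr.dvd_mul.1 (Nat.minFac_dvd (p * q)) with h | h
    · rw [(Nat.prime_dvd_prime_iff_eq hpr hp).1 h]; exact hlt.le
    · rw [(Nat.prime_dvd_prime_iff_eq hpr hq).1 h]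
  have : H.Normal := Subgroup.normal_of_index_eq_minFac_card (by rw [hHi, hG, hmin])
  have e : (G ⧸ H) ≃* Multiplicative (ZMod q) :=
    mulEquivOfPrimeCardEq (p := q) (by rw [← hHi]; rfl) (by simp)
  exact ⟨e.toMonoidHom.comp (QuotientGroup.mk' H),
    e.surjective.comp (QuotientGroup.mk'_surjective H)⟩

end Groups

theorem ZMod.addMonoidHom_apply {n : ℕ} (f : ZMod n →+ ZMod n) (x : ZMod n) :
    f x = f 1 * x := by
  obtain ⟨m, rfl⟩ := ZMod.intCast_surjective x
  have : (m : ZMod n) = m • (1 : ZMod n) := by simp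
  rw [this, map_zsmul, zsmul_eq_mul, zsmul_eq_mul, mul_one, mul_comm]

/-! ### The action `lam` and the opposite skew brace. -/

namespace SkewBrace

section Basic

variable {B : Type*} [SkewBrace B]

theorem mul_zero_eq (a : B) : a * 0 = a := by
  have h := mul_add_eq a 0 0
  rw [add_zero, add_assoc] at h
  have h2 : (0 : B) = -a + a * 0 := by
    apply add_left_cancel (a := a * 0); rw [add_zero]; exact h
  rw [eq_neg_add_iff_add_eq, add_zero] at h2
  exact h2.symm

theorem one_eq_zero : (1 : B) = 0 := by
  rw [← mul_zero_eq (1 : B), one_mul]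

/-- The map `b ↦ -a + a * b`. -/
def lam (a : B) : B →+ B where
  toFun b := -a + a * b
  map_zero' := by rw [mul_zero_eq, neg_add_cancel]
  map_add' b c := by rw [mul_add_eq]; simp only [add_assoc]

theorem mul_eq_add_lam (a b : B) : a * b = a + lam a b := by
  simp [lam]

theorem lam_mul (a b c : B) : lam (a * b) c = lam a (lam b c) := by
  have h : a * b * c = a * b + lam a (lam b c) := by
    rw [mul_assoc, mul_eq_add_lam b c, mul_eq_add_lam a, map_add, ← add_assoc, ← mul_eq_add_lam a b]
  rw [mul_eq_add_lam (a * b) c] at h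
  exact add_left_cancel h

theorem lam_one (b : B) : lam 1 b = b := by
  simp [lam, one_eq_zero (B := B) ▸ one_mul b, one_eq_zero (B := B)]

theorem lam_pow (a b : B) (n : ℕ) : lam (a ^ n) b = (lam a)^[n] b := by
  induction n generalizing b with
  | zero => simp [lam_one]
  | succ n ih => rw [pow_succ, lam_mul, ih, Function.iterate_succ_apply]

/-- The brace relation is its own mirror image when addition is reversed and multiplication is kept.
-/
instance : SkewBrace Bᵃᵒᵖ where
  mul_add_eq a b c := by
    apply AddOpposite.unop_injective
    simp only [AddOpposite.unop_mul, AddOpposite.unop_add, AddOpposite.unop_neg, mul_add_eq,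
      add_assoc]

end Basic

/-- A presentation of a skew brace as an extension of the trivial brace on `ZMod q` by the trivial
brace on `ZMod p`. -/
structure Extension (p q : ℕ) (B : Type*) [SkewBrace B] where
  /-- the projection -/
  proj : B →+ ZMod q
  /-- the inclusion of the kernel -/
  incl : ZMod p →+ B
  proj_mul : ∀ a b, proj (a * b) = proj a + proj b
  proj_surjective : Function.Surjective proj
  incl_injective : Function.Injective incl
  proj_eq_zero_iff : ∀ b, proj b = 0 ↔ ∃ x, incl x = b
  incl_mul_incl : ∀ x x', incl x * incl x' = incl (x + x')

/-! ### Every skew brace of order `pq` is an extension. -/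

section Existence

variable {p q : ℕ} [Fact p.Prime] [Fact q.Prime] {B : Type*} [SkewBrace B]

theorem exists_proj (hpq : p ≡ 1 [MOD q]) (hB : Nat.card B = p * q) :
    ∃ π : B →+ ZMod q, Function.Surjective π ∧ (∀ z, π z = 0 ↔ p • z = 0) ∧
      ∀ a b, π (a * b) = π a + π b := by
  obtain ⟨π', hπ'⟩ := exists_surjective_of_card_eq_mul hpq (G := Multiplicative B)
    (by rw [Nat.card_multiplicative, hB])
  let π : B →+ ZMod q := AddMonoidHom.toMultiplicative.symm π'
  have hsurj : Function.Surjective π := hπ'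
  have hker : ∀ z, π z = 0 ↔ p • z = 0 := fun z =>
    map_eq_one_iff_pow_eq_one hpq (G := Multiplicative B) (by rw [Nat.card_multiplicative, hB])
      π' hπ' (Multiplicative.ofAdd z)
  refine ⟨π, hsurj, hker, fun a b => ?_⟩
  have hinv : ∀ z, π z = 0 → π (lam a z) = 0 := fun z hz => by
    rw [hker] at hz ⊢
    rw [← map_nsmul, hz, map_zero]
  -- The map that `lam a` induces on `ZMod q` is multiplication by a scalar, read off at a lift of
  -- `1`.
  obtain ⟨y, hy⟩ := hsurj 1
  have hscale : ∀ z, π (lam a z) = π (lam a y) * π z := fun z => by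
    have h : π (z - (π z).val • y) = 0 := by
      rw [map_sub, map_nsmul, hy, nsmul_eq_mul, ZMod.natCast_zmod_val, mul_one, sub_self]
    have h2 := hinv _ h
    rw [map_sub, map_sub, map_nsmul, map_nsmul, nsmul_eq_mul, ZMod.natCast_zmod_val,
      sub_eq_zero] at h2
    rw [h2, mul_comm]
  set c := π (lam a y) with hc
  have hiter : ∀ n : ℕ, π ((lam a)^[n] y) = c ^ n := fun n => by
    induction n with
    | zero => simpa using hy
    | succ n ih => rw [Function.iterate_succ_apply', hscale, ih, pow_succ']
  have hcpow : c ^ (p * q) = 1 := by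
    rw [← hiter, ← lam_pow, ← hB, pow_card_eq_one', lam_one, hy]
  have hp : p.Prime := Fact.out
  have hq : q.Prime := Fact.out
  have hc0 : c ≠ 0 := by
    intro h
    rw [h, zero_pow (Nat.mul_pos hp.pos hq.pos).ne'] at hcpow
    exact zero_ne_one hcpow
  -- The order of `c` divides both `p * q` and `q - 1`, and these are coprime because `q - 1 < q <
  -- p`.
  have hc1 : c = 1 := by
    have h1 := ZMod.pow_card_sub_one_eq_one hc0
    have hlt := lt_of_modEq_one hpq
    have hcop : Nat.Coprime (p * q) (q - 1) := by
      have := hq.one_lt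
      refine Nat.Coprime.mul_left ?_ ?_ <;>
      exact Nat.coprime_of_lt_prime (by omega) (by omega) (by assumption)
    have h2 := orderOf_dvd_of_pow_eq_one h1
    have h3 := orderOf_dvd_of_pow_eq_one hcpow
    have h4 := Nat.dvd_gcd h3 h2
    rw [hcop.gcd_eq_one, Nat.dvd_one] at h4
    exact orderOf_eq_one_iff.1 h4
  rw [mul_eq_add_lam, map_add, hscale, hc1, one_mul]

theorem exists_extension (hpq : p ≡ 1 [MOD q]) (hB : Nat.card B = p * q) :
    Nonempty (Extension p q B) := by
  obtain ⟨π, hsurj, hker, hmul⟩ := exists_proj (p := p) (q := q) hpq hB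
  have hp : p.Prime := Fact.out
  let πm : B →* Multiplicative (ZMod q) :=
    MonoidHom.mk' (fun b => Multiplicative.ofAdd (π b)) fun a b => by rw [hmul]; rfl
  have hkerm : ∀ z, π z = 0 → z ^ p = 1 := fun z =>
    (map_eq_one_iff_pow_eq_one hpq hB πm hsurj z).1
  have hcard : Nat.card π.ker = p := card_ker_of_surjective (G := Multiplicative B)
    (by rw [Nat.card_multiplicative, hB]) (AddMonoidHom.toMultiplicative π) hsurj
  have : IsAddCyclic π.ker := isAddCyclic_of_prime_card hcard
  let e : ZMod p ≃+ π.ker := (ZMod.ringEquivCongr hcard.symm).toAddEquiv.trans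
    (zmodAddCyclicAddEquiv this)
  let ι : ZMod p →+ B := π.ker.subtype.comp e.toAddMonoidHom
  have hι : Function.Injective ι := Subtype.val_injective.comp e.injective
  have hrange : ∀ b, π b = 0 ↔ ∃ x, ι x = b := fun b => by
    constructor
    · intro h
      exact ⟨e.symm ⟨b, h⟩, by simp [ι]⟩
    · rintro ⟨x, rfl⟩
      exact (e x).2
  refine ⟨⟨π, ι, hmul, hsurj, hι, hrange, fun x x' => ?_⟩⟩
  have hinv : ∀ z, π (lam (ι x) (ι z)) = 0 := fun z => by
    have hz : π (ι z) = 0 := (hrange _).2 ⟨z, rfl⟩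
    rw [hker] at hz ⊢
    rw [← map_nsmul, hz, map_zero]
  let f : ZMod p →+ ZMod p := e.symm.toAddMonoidHom.comp
    (((lam (ι x)).comp ι).codRestrict π.ker hinv)
  have hf : ∀ z, lam (ι x) (ι z) = ι (f 1 * z) := fun z => by
    rw [← ZMod.addMonoidHom_apply]
    simp [ι, f]
  have hiter : ∀ n : ℕ, (lam (ι x))^[n] (ι 1) = ι (f 1 ^ n) := fun n => by
    induction n with
    | zero => simp
    | succ n ih => rw [Function.iterate_succ_apply', ih, hf, pow_succ']
  -- The element `ι x` has `p`-th power `1`, so `f 1 ^ p = 1`; by Fermat `f 1 ^ p = f 1`.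
  have h1 : f 1 = 1 := by
    apply hι
    have h := hiter p
    rw [← lam_pow, hkerm _ ((hrange _).2 ⟨x, rfl⟩), lam_one, ZMod.pow_card] at h
    exact h.symm
  rw [mul_eq_add_lam, hf, h1, one_mul, map_add]

end Existence

end SkewBrace

/-! ### The dichotomy and the good section of an extension. -/

namespace SkewBrace

namespace Extension

variable {p q : ℕ} {B : Type*} [SkewBrace B] (E : Extension p q B)

theorem proj_incl (x : ZMod p) : E.proj (E.incl x) = 0 :=
  (E.proj_eq_zero_iff _).2 ⟨x, rfl⟩

theorem proj_lam (a b : B) : E.proj (lam a b) = E.proj b := by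
  have h := E.proj_mul a b
  rw [mul_eq_add_lam, map_add] at h
  exact add_left_cancel h

theorem proj_pow (a : B) (n : ℕ) : E.proj (a ^ n) = n • E.proj a := by
  induction n with
  | zero => rw [pow_zero, one_eq_zero, map_zero, zero_nsmul]
  | succ n ih => rw [pow_succ, proj_mul, ih, succ_nsmul]

theorem exists_incl_add {a b : B} (h : E.proj a = E.proj b) : ∃ x, a = E.incl x + b := by
  obtain ⟨x, hx⟩ := (E.proj_eq_zero_iff (a - b)).1 (by rw [map_sub, h, sub_self])
  exact ⟨x, by rw [hx, sub_add_cancel]⟩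

theorem exists_incl_mul {a b : B} (h : E.proj a = E.proj b) : ∃ x, a = E.incl x * b := by
  obtain ⟨x, hx⟩ := (E.proj_eq_zero_iff (a * b⁻¹)).1 (by
    have h1 := E.proj_mul b b⁻¹
    rw [mul_inv_cancel, one_eq_zero, map_zero] at h1
    rw [proj_mul, h, ← h1])
  exact ⟨x, by rw [hx, inv_mul_cancel_right]⟩

theorem exists_scalar (f : B →+ B) (hf : ∀ x, E.proj (f (E.incl x)) = 0) :
    ∃ c, ∀ x, f (E.incl x) = E.incl (c * x) := by
  choose g hg using fun x => (E.proj_eq_zero_iff _).1 (hf x)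
  let g' : ZMod p →+ ZMod p := AddMonoidHom.mk' g fun x x' => E.incl_injective (by
    rw [map_add, hg, hg, hg, map_add, map_add])
  refine ⟨g' 1, fun x => ?_⟩
  rw [← ZMod.addMonoidHom_apply, ← hg]
  rfl

/-- The scalar by which additive conjugation by `b` acts on the kernel. -/
noncomputable def conj (b : B) : ZMod p :=
  (E.exists_scalar (AddAut.addConj b).toAddMonoidHom fun x => by
    simp [proj_incl]).choose

theorem add_incl (b : B) (x : ZMod p) : b + E.incl x = E.incl (E.conj b * x) + b := by
  have h := (E.exists_scalar (AddAut.addConj b).toAddMonoidHom fun x => by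
    simp [proj_incl]).choose_spec x
  rw [conj, ← h]
  simp

/-- The scalar by which `lam b` acts on the kernel. -/
noncomputable def act (b : B) : ZMod p :=
  (E.exists_scalar (lam b) fun x => by rw [proj_lam, proj_incl]).choose

theorem lam_incl (b : B) (x : ZMod p) : lam b (E.incl x) = E.incl (E.act b * x) :=
  (E.exists_scalar (lam b) fun x => by rw [proj_lam, proj_incl]).choose_spec x

theorem conj_eq_of_add_incl {b : B} {c : ZMod p} (h : b + E.incl 1 = E.incl c + b) :
    E.conj b = c := by
  rw [add_incl, mul_one] at h
  exact E.incl_injective (add_right_cancel h)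

theorem conj_add (a b : B) : E.conj (a + b) = E.conj a * E.conj b :=
  E.conj_eq_of_add_incl <| by
    rw [add_assoc, add_incl, mul_one, ← add_assoc, add_incl, add_assoc]

theorem conj_incl (x : ZMod p) : E.conj (E.incl x) = 1 :=
  E.conj_eq_of_add_incl <| by rw [← map_add, add_comm, map_add]

theorem conj_zero : E.conj 0 = 1 := by
  rw [← map_zero E.incl, conj_incl]

theorem act_mul (a b : B) : E.act (a * b) = E.act a * E.act b := by
  have h := lam_mul a b (E.incl 1)
  rw [lam_incl, lam_incl, lam_incl, mul_one, mul_one] at h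
  exact E.incl_injective h

theorem act_one : E.act 1 = 1 := by
  have h := lam_one (E.incl 1)
  rw [lam_incl, mul_one] at h
  exact E.incl_injective h

theorem lam_incl_incl (x z : ZMod p) : lam (E.incl x) (E.incl z) = E.incl z := by
  have h := E.incl_mul_incl x z
  rw [mul_eq_add_lam, map_add] at h
  exact add_left_cancel h

theorem exists_incl_add_nsmul [NeZero q] {y : B} (hy : E.proj y = 1) (b : B) :
    ∃ x, b = E.incl x + (E.proj b).val • y :=
  E.exists_incl_add (by
    rw [map_nsmul, hy, nsmul_eq_mul, ZMod.natCast_zmod_val, mul_one])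

/-- With `lam (incl x) y = incl (s * x) + y`, the first case is `s = 0`. For `s ≠ 0` the relations
force `conj y = 1 + s`, which says exactly that left multiplication by the kernel is right addition
on `y`, the trivial case for the opposite brace. -/
theorem lam_incl_eq_self_or_incl_mul_eq_add [Fact p.Prime] (y : B) :
    (∀ x, lam (E.incl x) y = y) ∨ ∀ x, E.incl x * y = y + E.incl x := by
  choose f hf using fun x => E.exists_incl_add (E.proj_lam (E.incl x) y)
  have hadd : ∀ x x', f (x + x') = f x + f x' := fun x x' => by
    apply E.incl_injective
    apply add_right_cancel (b := y)
    rw [← hf, add_comm x, ← incl_mul_incl, lam_mul, hf, map_add, lam_incl_incl, hf, ← add_assoc,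
      map_add]
  set s := f 1
  have hs : ∀ x, f x = s * x := fun x => ZMod.addMonoidHom_apply (AddMonoidHom.mk' f hadd) x
  obtain ⟨d, hd⟩ := E.exists_incl_add (E.proj_lam y y)
  -- This rewriting of `y * incl 1` as `incl z * y` is used twice: `h1` compares the two products as
  -- elements, `h2` compares how they act on `y` through `lam`.
  obtain ⟨z, hz⟩ := E.exists_incl_mul (a := y * E.incl 1) (b := y) (by
    rw [proj_mul, proj_incl, add_zero])
  have h1 : E.conj y * E.act y = z + s * z := by
    apply E.incl_injective
    apply add_right_cancel (b := y)
    rw [map_add, add_assoc, ← hs, ← hf, ← mul_eq_add_lam, ← hz, mul_eq_add_lam, lam_incl,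
      add_incl, mul_one]
  have h2 : E.act y * s = s * z := by
    have h := congrArg (fun a => lam a y) hz
    simp only [lam_mul] at h
    rw [hf, hd, map_add, map_add, lam_incl, lam_incl_incl, hd, hf, ← add_assoc, ← add_assoc,
      ← map_add, ← map_add, hs, hs, mul_one] at h
    have h' := E.incl_injective (add_right_cancel h)
    rw [add_comm] at h'
    exact add_left_cancel h'
  have hv : E.act y ≠ 0 := by
    intro h
    have h3 := E.act_mul y y⁻¹
    rw [mul_inv_cancel, act_one, h, zero_mul] at h3
    exact one_ne_zero h3
  by_cases h0 : s = 0
  · left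
    intro x
    rw [hf, hs, h0, zero_mul, map_zero, zero_add]
  · right
    intro x
    have hz' : z = E.act y := by
      rw [mul_comm] at h2
      exact (mul_left_cancel₀ h0 h2).symm
    have hu : E.conj y = 1 + s := by
      apply mul_right_cancel₀ hv
      rw [h1, hz']
      ring
    rw [mul_eq_add_lam, hf, hs, add_incl, hu, ← add_assoc, ← map_add, add_mul, one_mul]

theorem lam_incl_eq_self [NeZero q] {y : B} (hy : E.proj y = 1)
    (h : ∀ x, lam (E.incl x) y = y) (x : ZMod p) (b : B) : lam (E.incl x) b = b := by
  obtain ⟨z, hz⟩ := E.exists_incl_add_nsmul hy b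
  rw [hz, map_add, map_nsmul, lam_incl_incl, h]

/-- The multiple `q • b` lies in the kernel and commutes with `b`, while conjugation by `b` fixes
only `0` there. -/
theorem nsmul_eq_zero_of_conj_ne_one [Fact p.Prime] {b : B} (hb : E.conj b ≠ 1) :
    q • b = 0 := by
  obtain ⟨z, hz⟩ := (E.proj_eq_zero_iff (q • b)).1 (by simp)
  have h := E.add_incl b z
  rw [hz, ← succ_nsmul', succ_nsmul, ← hz] at h
  have h' := E.incl_injective (add_right_cancel h)
  rw [eq_comm, mul_left_eq_self₀] at h'
  rw [← hz, h'.resolve_left hb, map_zero]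

theorem exists_section [Fact p.Prime] [Fact q.Prime] (hpq : p ≠ q)
    (h : ∀ x b, lam (E.incl x) b = b) :
    ∃ y, E.proj y = 1 ∧ q • y = 0 ∧ lam y y = y := by
  have hq0 : (q : ZMod p) ≠ 0 := by
    rw [Ne, ZMod.natCast_eq_zero_iff, Nat.prime_dvd_prime_iff_eq Fact.out Fact.out]
    exact hpq
  have hcomm : ∀ {b : B}, E.conj b = 1 → ∀ x, q • (E.incl x + b) = E.incl (q * x) + q • b := by
    intro b hb x
    have : AddCommute (E.incl x) b := by
      have := E.add_incl b x
      rw [hb, one_mul] at this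
      exact this.symm
    rw [this.add_nsmul, ← map_nsmul, nsmul_eq_mul]
  obtain ⟨y, hy, hqy⟩ : ∃ y, E.proj y = 1 ∧ q • y = 0 := by
    obtain ⟨y, hy⟩ := E.proj_surjective 1
    by_cases hu : E.conj y = 1
    · obtain ⟨z, hz⟩ := (E.proj_eq_zero_iff (q • y)).1 (by simp)
      -- Here `y` commutes with the kernel, so shifting by `-(z / q)` changes `q • y = incl z` by
      -- `-z`.
      refine ⟨E.incl (-(z / q)) + y, by rw [map_add, proj_incl, zero_add, hy], ?_⟩
      rw [hcomm hu, ← hz, ← map_add, mul_neg, mul_div_cancel₀ _ hq0, neg_add_cancel, map_zero]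
    · exact ⟨y, hy, E.nsmul_eq_zero_of_conj_ne_one hu⟩
  obtain ⟨d, hd⟩ := E.exists_incl_add (E.proj_lam y y)
  by_cases hd0 : d = 0
  · exact ⟨y, hy, hqy, by rw [hd, hd0, map_zero, zero_add]⟩
  have hu : E.conj y ≠ 1 := by
    intro hu
    have h1 : q • lam y y = 0 := by rw [← map_nsmul, hqy, map_zero]
    rw [hd, hcomm hu, hqy, add_zero, ← map_zero E.incl] at h1
    exact (mul_ne_zero hq0 hd0) (E.incl_injective h1)
  -- If `act y = 1`, then `y ^ q` moves `y` by `q * d ≠ 0`, yet it lies in the kernel and so acts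
  -- trivially.
  have hv : E.act y ≠ 1 := by
    intro hv
    have hiter : ∀ n : ℕ, (lam y)^[n] y = E.incl (n * d) + y := fun n => by
      induction n with
      | zero => simp
      | succ n ih =>
        rw [Function.iterate_succ_apply', ih, map_add, lam_incl, hv, hd, ← add_assoc, ← map_add]
        congr 2
        push_cast
        ring
    have h1 := hiter q
    obtain ⟨z, hz⟩ := (E.proj_eq_zero_iff (y ^ q)).1 (by simp [proj_pow])
    rw [← lam_pow, ← hz, h, eq_comm, add_eq_right, ← map_zero E.incl] at h1
    exact (mul_ne_zero hq0 hd0) (E.incl_injective h1)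
  have hv' : 1 - E.act y ≠ 0 := sub_ne_zero.2 hv.symm
  -- This solves `x = act y * x + d`, the condition for `incl x + y` to be fixed by its own `lam`.
  -- The shift leaves `conj` unchanged and different from `1`, so `q • (incl x + y) = 0` is
  -- automatic.
  set x := d / (1 - E.act y) with hx
  have hxy : E.proj (E.incl x + y) = 1 := by rw [map_add, proj_incl, zero_add, hy]
  refine ⟨E.incl x + y, hxy, E.nsmul_eq_zero_of_conj_ne_one ?_, ?_⟩
  · rwa [conj_add, conj_incl, one_mul]
  · have h1 : E.incl x + y = E.incl x * y := by rw [mul_eq_add_lam, h]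
    nth_rewrite 1 [h1]
    rw [lam_mul, h, map_add, lam_incl, hd, ← add_assoc, ← map_add]
    congr 2
    rw [hx]
    field_simp
    ring

/-- The induced extension of the opposite skew brace. -/
def op : Extension p q Bᵃᵒᵖ where
  proj := AddMonoidHom.mk' (fun b => E.proj b.unop) fun a b => by
    rw [AddOpposite.unop_add, map_add, add_comm]
  incl := AddMonoidHom.mk' (fun x => AddOpposite.op (E.incl x)) fun a b => by
    rw [add_comm, map_add, AddOpposite.op_add]
  proj_mul a b := E.proj_mul a.unop b.unop
  proj_surjective x := by
    obtain ⟨b, hb⟩ := E.proj_surjective x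
    exact ⟨AddOpposite.op b, hb⟩
  incl_injective := AddOpposite.op_injective.comp E.incl_injective
  proj_eq_zero_iff b := by
    refine (E.proj_eq_zero_iff b.unop).trans (exists_congr fun x => ?_)
    exact ⟨fun h => AddOpposite.unop_injective h, fun h => congrArg AddOpposite.unop h⟩
  incl_mul_incl x x' := congrArg AddOpposite.op (E.incl_mul_incl x x')

end Extension

/-! ### The explicit models, and reduction to them. -/

/-- The set `ZMod p × ZMod q` in any universe, on which the parameters `e`, `i`, `j` define a skew
brace: `(x, k) + (x', k') = (x + e (i * k) * x', k + k')`, and `*` is the same with `j` for `i`. -/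
@[ext]
structure Model {p q : ℕ} (e : AddChar (ZMod q) (ZMod p)) (i j : ZMod q) : Type u where
  /-- the component in the kernel -/
  fst : ZMod p
  /-- the component in the quotient -/
  snd : ZMod q

namespace Model

variable {p q : ℕ} {e : AddChar (ZMod q) (ZMod p)} {i j : ZMod q}

instance : Add (Model e i j) := ⟨fun a b => ⟨a.fst + e (i * a.snd) * b.fst, a.snd + b.snd⟩⟩
instance : Zero (Model e i j) := ⟨⟨0, 0⟩⟩
instance : Neg (Model e i j) := ⟨fun a => ⟨-(e (-(i * a.snd)) * a.fst), -a.snd⟩⟩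
instance : Mul (Model e i j) := ⟨fun a b => ⟨a.fst + e (j * a.snd) * b.fst, a.snd + b.snd⟩⟩
instance : One (Model e i j) := ⟨⟨0, 0⟩⟩
instance : Inv (Model e i j) := ⟨fun a => ⟨-(e (-(j * a.snd)) * a.fst), -a.snd⟩⟩

@[simp] theorem fst_add (a b : Model e i j) : (a + b).fst = a.fst + e (i * a.snd) * b.fst := rfl
@[simp] theorem snd_add (a b : Model e i j) : (a + b).snd = a.snd + b.snd := rfl
@[simp] theorem fst_zero : (0 : Model e i j).fst = 0 := rfl
@[simp] theorem snd_zero : (0 : Model e i j).snd = 0 := rfl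
@[simp] theorem fst_neg (a : Model e i j) : (-a).fst = -(e (-(i * a.snd)) * a.fst) := rfl
@[simp] theorem snd_neg (a : Model e i j) : (-a).snd = -a.snd := rfl
@[simp] theorem fst_mul (a b : Model e i j) : (a * b).fst = a.fst + e (j * a.snd) * b.fst := rfl
@[simp] theorem snd_mul (a b : Model e i j) : (a * b).snd = a.snd + b.snd := rfl
@[simp] theorem fst_one : (1 : Model e i j).fst = 0 := rfl
@[simp] theorem snd_one : (1 : Model e i j).snd = 0 := rfl
@[simp] theorem fst_inv (a : Model e i j) : (a⁻¹).fst = -(e (-(j * a.snd)) * a.fst) := rfl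
@[simp] theorem snd_inv (a : Model e i j) : (a⁻¹).snd = -a.snd := rfl

instance : AddGroup (Model e i j) :=
  AddGroup.ofLeftAxioms
    (fun a b c => by
      ext <;> simp [mul_add, AddChar.map_add_eq_mul] <;> ring)
    (fun a => by ext <;> simp)
    (fun a => by ext <;> simp)

instance : Group (Model e i j) :=
  Group.ofLeftAxioms
    (fun a b c => by
      ext <;> simp [mul_add, AddChar.map_add_eq_mul] <;> ring)
    (fun a => by ext <;> simp)
    (fun a => by ext <;> simp)

theorem apply_mul_apply_neg (k : ZMod q) : e k * e (-k) = 1 := by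
  rw [← AddChar.map_add_eq_mul, add_neg_cancel, AddChar.map_zero_eq_one]

instance : SkewBrace (Model e i j) where
  mul_add_eq a b c := by
    ext
    · simp only [fst_mul, fst_add, snd_mul, snd_add, snd_neg, fst_neg, mul_add, mul_neg,
        AddChar.map_add_eq_mul]
      linear_combination -(e (i * b.snd) * e (j * a.snd) * c.fst) *
        apply_mul_apply_neg (e := e) (i * a.snd)
    · simp; abel

end Model

end SkewBrace

theorem AddChar.eq_one_iff_of_injective {A M : Type*} [AddMonoid A] [Monoid M]
    {e : AddChar A M} (he : Function.Injective e) {a : A} : e a = 1 ↔ a = 0 :=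
  ⟨fun h => he (by rw [h, AddChar.map_zero_eq_one]), fun h => by rw [h, AddChar.map_zero_eq_one]⟩

/-- The value `e 1` is a primitive `q`-th root of unity in a field, so `ψ 1` is a power of it. -/
theorem AddChar.exists_eq_apply_mul {p q : ℕ} [Fact p.Prime] [Fact q.Prime]
    {e : AddChar (ZMod q) (ZMod p)} (he : Function.Injective e) (ψ : AddChar (ZMod q) (ZMod p)) :
    ∃ i, ∀ k, ψ k = e (i * k) := by
  have hpow : ∀ f : AddChar (ZMod q) (ZMod p), f 1 ^ q = 1 := fun f => by
    rw [← AddChar.map_nsmul_eq_pow, nsmul_eq_mul, CharP.cast_eq_zero, zero_mul,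
      AddChar.map_zero_eq_one]
  have hprim : IsPrimitiveRoot (e 1) q := by
    have h : orderOf (e 1) = q := orderOf_eq_prime (hpow e) (by
      rw [Ne, AddChar.eq_one_iff_of_injective he]
      exact one_ne_zero)
    exact IsPrimitiveRoot.iff_orderOf.2 h
  obtain ⟨m, -, hm⟩ := hprim.eq_pow_of_pow_eq_one (hpow ψ)
  refine ⟨m, fun k => ?_⟩
  have hk : k = k.val • (1 : ZMod q) := by simp
  have hk' : (m : ZMod q) * k = k.val • m • (1 : ZMod q) := by simp [mul_comm]
  rw [hk', AddChar.map_nsmul_eq_pow, AddChar.map_nsmul_eq_pow, hm]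
  nth_rewrite 1 [hk]
  rw [AddChar.map_nsmul_eq_pow]

namespace SkewBrace

variable {p q : ℕ} [Fact p.Prime] [Fact q.Prime]

theorem Extension.exists_equiv_model {e : AddChar (ZMod q) (ZMod p)} (he : Function.Injective e)
    {B : Type*} [SkewBrace B] (E : Extension p q B) (hpq : p ≠ q)
    (h : ∀ x b, lam (E.incl x) b = b) :
    ∃ i j, Nonempty (B ≃+* Model.{u} e i j) := by
  obtain ⟨y, hy, hqy, hyy⟩ := E.exists_section hpq h
  let κ : ZMod q →+ B := ZMod.lift q ⟨zmultiplesHom B y, by simpa using hqy⟩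
  have hκ : ∀ k : ZMod q, κ k = k.val • y := fun k => by
    have h1 : κ ((k.val : ℤ) : ZMod q) = (k.val : ℤ) • y := ZMod.lift_coe q _ _
    rwa [natCast_zsmul, Int.cast_natCast, ZMod.natCast_zmod_val] at h1
  have hproj : ∀ k, E.proj (κ k) = k := fun k => by
    rw [hκ, map_nsmul, hy, nsmul_eq_mul, ZMod.natCast_zmod_val, mul_one]
  have hypow : ∀ n : ℕ, y ^ n = n • y := fun n => by
    induction n with
    | zero => rw [pow_zero, zero_nsmul, one_eq_zero]
    | succ n ih => rw [pow_succ', ih, mul_eq_add_lam, map_nsmul, hyy, succ_nsmul']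
  have hlam : ∀ k k', lam (κ k) (κ k') = κ k' := fun k k' => by
    rw [hκ, hκ, map_nsmul, ← hypow, lam_pow, Function.iterate_fixed hyy]
  have hmul : ∀ k k', κ k * κ k' = κ (k + k') := fun k k' => by
    rw [mul_eq_add_lam, hlam, map_add]
  let ψ : AddChar (ZMod q) (ZMod p) :=
    { toFun := fun k => E.conj (κ k)
      map_zero_eq_one' := by rw [map_zero, conj_zero]
      map_add_eq_mul' := fun k k' => by rw [map_add, conj_add] }
  -- This scalar is multiplicative conjugation on the kernel: `κ k * incl x = incl (θ k * x) * κ k`.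
  let θ : AddChar (ZMod q) (ZMod p) :=
    { toFun := fun k => E.conj (κ k) * E.act (κ k)
      map_zero_eq_one' := by rw [map_zero, conj_zero, ← one_eq_zero, act_one, one_mul]
      map_add_eq_mul' := fun k k' => by
        rw [map_add, conj_add, ← map_add, ← hmul, act_mul]
        ring }
  obtain ⟨i, hi⟩ := AddChar.exists_eq_apply_mul he ψ
  obtain ⟨j, hj⟩ := AddChar.exists_eq_apply_mul he θ
  have hi' : ∀ k, E.conj (κ k) = e (i * k) := hi
  have hj' : ∀ k, E.conj (κ k) * E.act (κ k) = e (j * k) := hj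
  let F : Model.{u} e i j → B := fun a => E.incl a.fst + κ a.snd
  have hF : Function.Bijective F := by
    refine ⟨fun a a' h => ?_, fun b => ?_⟩
    · have h1 := congrArg E.proj h
      simp only [F, map_add, proj_incl, zero_add, hproj] at h1
      simp only [F, h1] at h
      exact Model.ext (E.incl_injective (add_right_cancel h)) h1
    · obtain ⟨x, hx⟩ := E.exists_incl_add (a := b) (b := κ (E.proj b)) (hproj _).symm
      exact ⟨⟨x, E.proj b⟩, hx.symm⟩
  have hadd : ∀ a a', F (a + a') = F a + F a' := fun a a' => by
    simp only [F, Model.fst_add, Model.snd_add]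
    rw [← hi', map_add, map_add, add_assoc, ← add_assoc (E.incl _) (κ _), ← add_incl]
    simp only [add_assoc]
  have hmulF : ∀ a a', F (a * a') = F a * F a' := fun a a' => by
    have h1 : F a = E.incl a.fst * κ a.snd := by rw [mul_eq_add_lam, h]
    have h2 : lam (F a) (F a') = E.incl (E.act (κ a.snd) * a'.fst) + κ a'.snd := by
      rw [h1, lam_mul, h, map_add, lam_incl, hlam]
    rw [mul_eq_add_lam (F a), h2]
    simp only [F, Model.fst_mul, Model.snd_mul]
    rw [← hj', map_add, map_add, add_assoc, ← add_assoc (E.incl _) (κ _), mul_assoc, ← add_incl]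
    simp only [add_assoc]
  exact ⟨i, j, ⟨RingEquiv.symm { Equiv.ofBijective F hF with
    map_add' := hadd, map_mul' := hmulF }⟩⟩

/-- Every skew brace of order `pq` or its opposite is isomorphic to a model. -/
theorem exists_equiv_model (hpq : p ≡ 1 [MOD q]) {e : AddChar (ZMod q) (ZMod p)}
    (he : Function.Injective e) {B : Type*} [SkewBrace B] (hB : Nat.card B = p * q) :
    ∃ i j, Nonempty (B ≃+* Model.{u} e i j) ∨ Nonempty (Bᵃᵒᵖ ≃+* Model.{u} e i j) := by
  obtain ⟨E⟩ := exists_extension hpq hB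
  have hne : p ≠ q := (lt_of_modEq_one hpq).ne'
  obtain ⟨y, hy⟩ := E.proj_surjective 1
  rcases E.lam_incl_eq_self_or_incl_mul_eq_add y with h | h
  · obtain ⟨i, j, hij⟩ := E.exists_equiv_model he hne (E.lam_incl_eq_self hy h)
    exact ⟨i, j, Or.inl hij⟩
  · have h' : ∀ x, lam (E.op.incl x) (AddOpposite.op y) = AddOpposite.op y := fun x => by
      apply add_left_cancel (a := E.op.incl x)
      rw [← mul_eq_add_lam]
      exact congrArg AddOpposite.op (h x)
    obtain ⟨i, j, hij⟩ := E.op.exists_equiv_model he hne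
      (E.op.lam_incl_eq_self (y := AddOpposite.op y) hy h')
    exact ⟨i, j, Or.inr hij⟩

end SkewBrace

/-- An isomorphism from an additive opposite, as an isomorphism to an additive opposite. -/
def RingEquiv.opOfOp {B : Type*} {C : Type*} [Add B] [Mul B] [Add C] [Mul C] (f : Bᵃᵒᵖ ≃+* C) :
    B ≃+* Cᵃᵒᵖ where
  toFun b := AddOpposite.op (f (AddOpposite.op b))
  invFun c := (f.symm c.unop).unop
  left_inv b := by simp
  right_inv c := by simp
  map_add' a b := by simp
  map_mul' a b := by simp

/-- The isomorphism underlying an isomorphism of additive opposites. -/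
def RingEquiv.ofOpOp {B : Type*} {C : Type*} [Add B] [Mul B] [Add C] [Mul C]
    (f : Bᵃᵒᵖ ≃+* Cᵃᵒᵖ) : B ≃+* C where
  toFun b := (f (AddOpposite.op b)).unop
  invFun c := (f.symm (AddOpposite.op c)).unop
  left_inv b := by simp
  right_inv c := by simp
  map_add' a b := by simp
  map_mul' a b := by simp

/-- A commutative addition agrees with its opposite. -/
def RingEquiv.opOfAddComm {B : Type*} [Add B] [Mul B] (h : ∀ a b : B, a + b = b + a) :
    B ≃+* Bᵃᵒᵖ where
  toFun b := AddOpposite.op b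
  invFun c := c.unop
  map_add' a b := by rw [h, AddOpposite.op_add]
  map_mul' a b := rfl

/-! ### Isomorphisms and invariants of the models. -/

namespace SkewBrace.Model

variable {p q : ℕ} {e : AddChar (ZMod q) (ZMod p)} {i j : ZMod q}

/-- The underlying pair. -/
def equivProd : Model.{u} e i j ≃ ZMod p × ZMod q where
  toFun a := (a.fst, a.snd)
  invFun a := ⟨a.1, a.2⟩

theorem card_eq : Nat.card (Model.{u} e i j) = p * q := by
  rw [Nat.card_congr equivProd, Nat.card_prod, Nat.card_zmod, Nat.card_zmod]

/-- The second component as an additive homomorphism. -/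
def sndHom : Model.{u} e i j →+ ZMod q where
  toFun := snd
  map_zero' := rfl
  map_add' _ _ := rfl

/-- The elements with trivial second component. -/
def inclHom : ZMod p →+ Model.{u} e i j where
  toFun x := ⟨x, 0⟩
  map_zero' := rfl
  map_add' x x' := by ext <;> simp

theorem nsmul_inclHom (x : ZMod p) : p • (inclHom x : Model.{u} e i j) = 0 := by
  rw [← map_nsmul, nsmul_eq_mul, CharP.cast_eq_zero, zero_mul, map_zero]

theorem snd_eq_zero_of_nsmul_eq_zero (hpq : p ≡ 1 [MOD q]) {a : Model.{u} e i j}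
    (ha : p • a = 0) : a.snd = 0 := by
  have h := congrArg sndHom ha
  rw [map_nsmul, nsmul_eq_mul, (ZMod.natCast_eq_natCast_iff p 1 q).2 hpq, Nat.cast_one, one_mul,
    map_zero] at h
  exact h

/-- Multiplying both parameters by a unit does not change the isomorphism type. -/
def rescale [Fact q.Prime] (i j : ZMod q) {r : ZMod q} (hr : r ≠ 0) :
    Model.{u} e i j ≃+* Model.{v} e (i * r) (j * r) where
  toFun a := ⟨a.fst, r⁻¹ * a.snd⟩
  invFun a := ⟨a.fst, r * a.snd⟩
  left_inv a := by ext <;> simp [hr]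
  right_inv a := by ext <;> simp [hr]
  map_add' a b := by ext <;> simp [hr, mul_add, mul_assoc]
  map_mul' a b := by ext <;> simp [hr, mul_add, mul_assoc]

section Comm

theorem add_comm_of_eq_zero (a b : Model.{u} e 0 j) : a + b = b + a := by
  ext <;> simp [add_comm]

theorem mul_comm_of_eq_zero (a b : Model.{u} e i 0) : a * b = b * a := by
  ext <;> simp [add_comm]

variable [Fact p.Prime] [Fact q.Prime]

theorem add_comm_iff (he : Function.Injective e) :
    (∀ a b : Model.{u} e i j, a + b = b + a) ↔ i = 0 := by
  constructor
  · intro h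
    have h1 := congrArg fst (h ⟨0, 1⟩ ⟨1, 0⟩)
    simpa [AddChar.eq_one_iff_of_injective he] using h1
  · rintro rfl
    exact add_comm_of_eq_zero

theorem mul_comm_iff (he : Function.Injective e) :
    (∀ a b : Model.{u} e i j, a * b = b * a) ↔ j = 0 := by
  constructor
  · intro h
    have h1 := congrArg fst (h ⟨0, 1⟩ ⟨1, 0⟩)
    simpa [AddChar.eq_one_iff_of_injective he] using h1
  · rintro rfl
    exact mul_comm_of_eq_zero

/-- An isomorphism preserves the `p`-torsion and scales it by some `g 1 ≠ 0`. Conjugation by `⟨0,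
1⟩` on it, additive and multiplicative, is by `e 1` and `e j`. The first pins down the second
component of the image of `⟨0, 1⟩`, the second then gives `j`. -/
theorem eq_of_equiv (hpq : p ≡ 1 [MOD q]) (he : Function.Injective e) {j j' : ZMod q}
    (f : Model.{u} e 1 j ≃+* Model.{v} e 1 j') : j = j' := by
  have hsnd : ∀ x, (f (inclHom x)).snd = 0 := fun x =>
    snd_eq_zero_of_nsmul_eq_zero hpq (by
      have h := map_nsmul f.toAddEquiv p (inclHom x)
      rw [nsmul_inclHom, map_zero] at h
      exact h.symm)
  let g : ZMod p →+ ZMod p := AddMonoidHom.mk' (fun x => (f (inclHom x)).fst) fun x x' => by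
    rw [map_add, map_add, fst_add, hsnd, mul_zero, AddChar.map_zero_eq_one, one_mul]
  have hf : ∀ x, f (inclHom x) = inclHom (g 1 * x) := fun x => by
    rw [← ZMod.addMonoidHom_apply]
    exact Model.ext rfl (hsnd x)
  have hc : g 1 ≠ 0 := by
    intro h
    have h1 : f (inclHom 1) = f (inclHom 0) := by rw [hf, hf, h, zero_mul, zero_mul]
    exact one_ne_zero (congrArg fst (f.injective h1))
  have ha : (⟨0, 1⟩ : Model.{u} e 1 j) + inclHom 1 = inclHom (e 1) + ⟨0, 1⟩ := by
    ext <;> simp [inclHom]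
  have hm : (⟨0, 1⟩ : Model.{u} e 1 j) * inclHom 1 = inclHom (e j) * ⟨0, 1⟩ := by
    ext <;> simp [inclHom]
  have ha' := congrArg (fun a => (f a).fst) ha
  have hm' := congrArg (fun a => (f a).fst) hm
  simp only [map_add, map_mul, hf] at ha' hm'
  set z := f ⟨0, 1⟩
  have h1 : e z.snd = e 1 := by
    apply mul_left_cancel₀ hc
    simp [inclHom] at ha'
    linear_combination ha'
  have h2 : e j' = e j := by
    apply mul_left_cancel₀ hc
    simp [inclHom, he h1] at hm'
    linear_combination hm'
  exact (he h2).symm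

/-- In a model, left multiplication by the kernel is left addition. In the opposite it is right
addition in terms of the reversed sum, and with `i = 1` the two differ on an element over `1`. -/
theorem not_equiv_op (hpq : p ≡ 1 [MOD q]) (he : Function.Injective e) {j j' : ZMod q}
    (f : Model.{u} e 1 j ≃+* (Model.{v} e 1 j')ᵃᵒᵖ) : False := by
  set a := (f (inclHom 1)).unop with ha
  have hsnd : a.snd = 0 := snd_eq_zero_of_nsmul_eq_zero hpq (by
      have h := map_nsmul f.toAddEquiv p (inclHom 1)
      rw [nsmul_inclHom, map_zero] at h
      exact (congrArg AddOpposite.unop h).symm)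
  have hc : a.fst ≠ 0 := by
    intro h
    have h1 : f (inclHom 1) = 0 := AddOpposite.unop_injective (Model.ext h hsnd)
    rw [← map_zero f.toAddEquiv] at h1
    exact one_ne_zero (congrArg fst (f.injective h1))
  obtain ⟨y, hy⟩ := f.surjective (AddOpposite.op ⟨0, 1⟩)
  have h1 : (inclHom 1 : Model.{u} e 1 j) * y = inclHom 1 + y := by
    ext <;> simp [inclHom]
  have h2 := congrArg (fun b => (f b).unop.fst) h1
  simp only [map_add, map_mul, hy, AddOpposite.unop_add, AddOpposite.unop_mul, ← ha,
    AddOpposite.unop_op, fst_add, fst_mul, hsnd, mul_zero, one_mul, add_zero, zero_add] at h2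
  have h3 : e 1 = 1 := by
    apply mul_right_cancel₀ hc
    rw [← h2, one_mul]
  exact one_ne_zero ((AddChar.eq_one_iff_of_injective he).1 h3)

end Comm

section Groups

/-- The multiplicative group of a model with `j = 0` is cyclic. -/
def mulEquivCyc (h : p.Coprime q) : Model.{u} e i 0 ≃* Cyc (p * q) :=
  MulEquiv.trans
    { equivProd.trans Multiplicative.ofAdd with
      map_mul' := fun a b => by
        apply Multiplicative.toAdd.injective
        simp [equivProd] }
    (AddEquiv.toMultiplicative (ZMod.chineseRemainder h).symm.toAddEquiv)

/-- The multiplicative group of a model with `j ≠ 0` is a semidirect product. -/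
def mulEquivSemidirectProduct [Fact q.Prime] {φ : Cyc q →* MulAut (Cyc p)}
    (hφ : ∀ k x, φ (Multiplicative.ofAdd k) (Multiplicative.ofAdd x) =
      Multiplicative.ofAdd (e k * x)) (hj : j ≠ 0) :
    Model.{u} e i j ≃* Cyc p ⋊[φ] Cyc q where
  toFun a := ⟨Multiplicative.ofAdd a.fst, Multiplicative.ofAdd (j * a.snd)⟩
  invFun a := ⟨a.left.toAdd, j⁻¹ * a.right.toAdd⟩
  left_inv a := by ext <;> simp [hj]
  right_inv a := by ext <;> simp [hj]
  map_mul' a b := by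
    ext
    · simp [hφ]
    · simp [mul_add]

end Groups

end SkewBrace.Model

/-! ### Characters and actions of `C_q` on `C_p`. -/

section Characters

variable {p q : ℕ} [Fact q.Prime]

theorem AddChar.injective_of_apply_ne_one {M : Type*} [CommMonoid M] {e : AddChar (ZMod q) M}
    {k : ZMod q} (hk : e k ≠ 1) : Function.Injective e := by
  intro a b hab
  by_contra hne
  have hsub : a - b ≠ 0 := sub_ne_zero.2 hne
  have h1 : e (a - b) = 1 := by
    rw [sub_eq_add_neg, AddChar.map_add_eq_mul, hab, ← AddChar.map_add_eq_mul, add_neg_cancel,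
      AddChar.map_zero_eq_one]
  apply hk
  have h2 : k = (k / (a - b)).val • (a - b) := by
    rw [nsmul_eq_mul, ZMod.natCast_zmod_val, div_mul_cancel₀ _ hsub]
  rw [h2, AddChar.map_nsmul_eq_pow, h1, one_pow]

theorem exists_injective_addChar [Fact p.Prime] (hpq : p ≡ 1 [MOD q]) :
    ∃ e : AddChar (ZMod q) (ZMod p), Function.Injective e := by
  have hq : q.Prime := Fact.out
  obtain ⟨g, hg⟩ := exists_prime_orderOf_dvd_card' (G := (ZMod p)ˣ) q (by
    rw [Nat.card_eq_fintype_card, ZMod.card_units]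
    exact (Nat.modEq_iff_dvd' (Fact.out : p.Prime).one_lt.le).1 hpq.symm)
  have hgq : (g : ZMod p) ^ q = 1 := by
    rw [← Units.val_pow_eq_pow_val, ← hg, pow_orderOf_eq_one, Units.val_one]
  refine ⟨AddChar.zmodChar q hgq, AddChar.injective_of_apply_ne_one (k := 1) ?_⟩
  have := AddChar.zmodChar_apply' hgq 1
  rw [Nat.cast_one, pow_one] at this
  rw [this, Ne, Units.val_eq_one]
  rintro rfl
  rw [orderOf_one] at hg
  exact hq.one_lt.ne hg

/-- The action of `C_q` on `C_p` defined by a character. -/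
def AddChar.toAction (e : AddChar (ZMod q) (ZMod p)) : Cyc q →* MulAut (Cyc p) :=
  MonoidHom.mk' (fun k =>
    { toFun := fun x => Multiplicative.ofAdd (e k.toAdd * x.toAdd)
      invFun := fun x => Multiplicative.ofAdd (e (-k.toAdd) * x.toAdd)
      left_inv := fun x => by
        simp [← mul_assoc, ← AddChar.map_add_eq_mul]
      right_inv := fun x => by
        simp [← mul_assoc, ← AddChar.map_add_eq_mul]
      map_mul' := fun x y => by simp [mul_add] }) fun k k' => by
    ext x
    apply Multiplicative.toAdd.injective
    simp [AddChar.map_add_eq_mul, mul_assoc]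

theorem AddChar.toAction_ne_one [Fact p.Prime] {e : AddChar (ZMod q) (ZMod p)}
    (he : Function.Injective e) : e.toAction ≠ 1 := by
  intro h
  have h1 := congrArg (fun f => (f (Multiplicative.ofAdd 1) (Multiplicative.ofAdd 1)).toAdd) h
  have h2 : e 1 = 1 := by simpa [AddChar.toAction] using h1
  exact one_ne_zero ((AddChar.eq_one_iff_of_injective he).1 h2)

/-- Every endomorphism of `C_p` is multiplication by a scalar, and a nontrivial character of a group
of prime order is injective. -/
theorem exists_addChar_of_action {φ : Cyc q →* MulAut (Cyc p)} (hφ : φ ≠ 1) :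
    ∃ e : AddChar (ZMod q) (ZMod p), Function.Injective e ∧
      ∀ k x, φ (Multiplicative.ofAdd k) (Multiplicative.ofAdd x) =
        Multiplicative.ofAdd (e k * x) := by
  have hlin : ∀ k x, (φ (Multiplicative.ofAdd k) (Multiplicative.ofAdd x)).toAdd =
      (φ (Multiplicative.ofAdd k) (Multiplicative.ofAdd 1)).toAdd * x := fun k x =>
    ZMod.addMonoidHom_apply (AddMonoidHom.toMultiplicative.symm
      (φ (Multiplicative.ofAdd k)).toMonoidHom) x
  let e : AddChar (ZMod q) (ZMod p) :=
    { toFun := fun k => (φ (Multiplicative.ofAdd k) (Multiplicative.ofAdd 1)).toAdd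
      map_zero_eq_one' := by simp
      map_add_eq_mul' := fun k k' => by
        rw [ofAdd_add, map_mul, MulAut.mul_apply]
        exact hlin k _ }
  have he : ∀ k x, φ (Multiplicative.ofAdd k) (Multiplicative.ofAdd x) =
      Multiplicative.ofAdd (e k * x) := fun k x =>
    Multiplicative.toAdd.injective (hlin k x)
  obtain ⟨k, hk⟩ : ∃ k, e k ≠ 1 := by
    by_contra! h
    apply hφ
    refine MonoidHom.ext fun k => MulEquiv.ext fun x => ?_
    have := he k.toAdd x.toAdd
    rw [h, one_mul] at this
    exact this
  exact ⟨e, AddChar.injective_of_apply_ne_one hk, he⟩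

end Characters

/-! ### Groups of order `pq` classified by commutativity. -/

section GroupClassification

open SkewBrace

variable {p q : ℕ} [Fact p.Prime] [Fact q.Prime] {e : AddChar (ZMod q) (ZMod p)}

theorem exists_mulEquiv_model (hpq : p ≡ 1 [MOD q]) (he : Function.Injective e) {G : Type*}
    [hG : Group G] (hcard : Nat.card G = p * q) :
    ∃ i j, Nonempty (G ≃* Model.{u} e i j) := by
  -- The trivial skew brace, with both operations equal to that of `G`, turns the brace
  -- classification into one of groups.
  let _ : SkewBrace G :=
    { (inferInstance : AddGroup (Additive G)), hG with
      mul_add_eq := fun a b c => by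
        change a * (b * c) = a * b * a⁻¹ * (a * c)
        group }
  obtain ⟨i, j, (⟨⟨f⟩⟩ | ⟨⟨f⟩⟩)⟩ := exists_equiv_model.{u} hpq he hcard
  · exact ⟨i, j, ⟨f.toMulEquiv⟩⟩
  · exact ⟨i, j, ⟨AddOpposite.opMulEquiv.trans f.toMulEquiv⟩⟩

theorem MulEquiv.mul_comm_iff {G H : Type*} [Mul G] [Mul H] (f : G ≃* H) :
    (∀ a b : G, a * b = b * a) ↔ ∀ a b : H, a * b = b * a := by
  refine ⟨fun h a b => ?_, fun h a b => ?_⟩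
  · apply f.symm.injective
    rw [map_mul, map_mul, h]
  · apply f.injective
    rw [map_mul, map_mul, h]

theorem nonempty_mulEquiv_cyc_iff (hpq : p ≡ 1 [MOD q]) {G : Type*} [Group G]
    (hcard : Nat.card G = p * q) :
    Nonempty (G ≃* Cyc (p * q)) ↔ ∀ a b : G, a * b = b * a := by
  refine ⟨fun ⟨f⟩ => f.mul_comm_iff.2 mul_comm, fun h => ?_⟩
  obtain ⟨e, he⟩ := exists_injective_addChar (p := p) (q := q) hpq
  obtain ⟨i, j, ⟨f⟩⟩ := exists_mulEquiv_model.{0} hpq he hcard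
  obtain rfl := (Model.mul_comm_iff he).1 (f.mul_comm_iff.1 h)
  exact ⟨f.trans (Model.mulEquivCyc
    ((Nat.coprime_primes Fact.out Fact.out).2 (lt_of_modEq_one hpq).ne'))⟩

theorem nonempty_mulEquiv_semidirectProduct_iff (hpq : p ≡ 1 [MOD q])
    {φ : Cyc q →* MulAut (Cyc p)} (hφ : φ ≠ 1) {G : Type*} [Group G]
    (hcard : Nat.card G = p * q) :
    Nonempty (G ≃* Cyc p ⋊[φ] Cyc q) ↔ ¬ ∀ a b : G, a * b = b * a := by
  obtain ⟨e, he, hφe⟩ := exists_addChar_of_action hφ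
  constructor
  · rintro ⟨f⟩ h
    have f' := f.trans (Model.mulEquivSemidirectProduct.{0} (i := 0) hφe one_ne_zero).symm
    exact one_ne_zero ((Model.mul_comm_iff he).1 (f'.mul_comm_iff.1 h))
  · intro h
    obtain ⟨i, j, ⟨f⟩⟩ := exists_mulEquiv_model.{0} hpq he hcard
    rw [f.mul_comm_iff, Model.mul_comm_iff he] at h
    exact ⟨f.trans (Model.mulEquivSemidirectProduct hφe h)⟩

end GroupClassification

/-! ### The list of representatives is complete and irredundant. -/

namespace BundledSkewBrace

open SkewBrace

variable {p q : ℕ}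

/-- Representatives of the isomorphism types of skew braces of order `pq`. -/
def rep (e : AddChar (ZMod q) (ZMod p)) : Bool ⊕ (Bool × ZMod q) → BundledSkewBrace.{u}
  | .inl false => ⟨Model e 0 0⟩
  | .inl true => ⟨Model e 0 1⟩
  | .inr (false, j) => ⟨Model e 1 j⟩
  | .inr (true, j) => ⟨(Model e 1 j)ᵃᵒᵖ⟩

/-- The parameter of the multiplicative group of a representative. -/
def mulParam : Bool ⊕ (Bool × ZMod q) → ZMod q
  | .inl false => 0
  | .inl true => 1
  | .inr (_, j) => j

theorem card_rep (e : AddChar (ZMod q) (ZMod p)) (r : Bool ⊕ (Bool × ZMod q)) :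
    Nat.card (rep.{u} e r).carrier = p * q := by
  match r with
  | .inl false => exact Model.card_eq
  | .inl true => exact Model.card_eq
  | .inr (false, j) => exact Model.card_eq
  | .inr (true, j) => exact (Nat.card_congr AddOpposite.opEquiv.symm).trans Model.card_eq

variable [Fact p.Prime] [Fact q.Prime] {e : AddChar (ZMod q) (ZMod p)}

theorem rep_mul_comm_iff (he : Function.Injective e) (r : Bool ⊕ (Bool × ZMod q)) :
    (∀ a b : (rep.{u} e r).carrier, a * b = b * a) ↔ mulParam r = 0 := by
  match r with
  | .inl false => exact Model.mul_comm_iff he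
  | .inl true => exact Model.mul_comm_iff he
  | .inr (false, j) => exact Model.mul_comm_iff he
  | .inr (true, j) => exact AddOpposite.opMulEquiv.symm.mul_comm_iff.trans (Model.mul_comm_iff he)

theorem rep_add_comm_iff (he : Function.Injective e) (r : Bool ⊕ (Bool × ZMod q)) :
    (∀ a b : (rep.{u} e r).carrier, a + b = b + a) ↔ r.isLeft := by
  match r with
  | .inl false => exact (Model.add_comm_iff he).trans (by simp)
  | .inl true => exact (Model.add_comm_iff he).trans (by simp)
  | .inr (false, j) => exact (Model.add_comm_iff he).trans (by simp)
  | .inr (true, j) =>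
    have : (∀ a b : (Model.{u} e 1 j)ᵃᵒᵖ, a + b = b + a) ↔
        ∀ a b : Model.{u} e 1 j, a + b = b + a :=
      ⟨fun h a b => AddOpposite.op_injective (h (AddOpposite.op b) (AddOpposite.op a)),
        fun h a b => AddOpposite.unop_injective (h b.unop a.unop)⟩
    exact this.trans ((Model.add_comm_iff he).trans (by simp))

theorem exists_equiv_rep (hpq : p ≡ 1 [MOD q]) (he : Function.Injective e)
    (B : BundledSkewBrace.{u}) (hB : Nat.card B.carrier = p * q) :
    ∃ r, Nonempty (B.carrier ≃+* (rep.{u} e r).carrier) := by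
  have hzero : ∀ j : ZMod q, ∃ r, Nonempty (Model.{u} e 0 j ≃+* (rep.{u} e r).carrier) := by
    intro j
    by_cases hj : j = 0
    · subst hj
      exact ⟨.inl false, ⟨RingEquiv.refl _⟩⟩
    · have f := Model.rescale.{u, u} (e := e) 0 j (inv_ne_zero hj)
      rw [zero_mul, mul_inv_cancel₀ hj] at f
      exact ⟨.inl true, ⟨f⟩⟩
  have hone : ∀ i j : ZMod q, i ≠ 0 → ∃ j', Nonempty (Model.{u} e i j ≃+* Model.{u} e 1 j') := by
    intro i j hi
    have f := Model.rescale.{u, u} (e := e) i j (inv_ne_zero hi)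
    rw [mul_inv_cancel₀ hi] at f
    exact ⟨_, ⟨f⟩⟩
  obtain ⟨i, j, (⟨⟨f⟩⟩ | ⟨⟨f⟩⟩)⟩ := exists_equiv_model.{u} hpq he hB
  · by_cases hi : i = 0
    · subst hi
      obtain ⟨r, ⟨g⟩⟩ := hzero j
      exact ⟨r, ⟨f.trans g⟩⟩
    · obtain ⟨j', ⟨g⟩⟩ := hone i j hi
      exact ⟨.inr (false, j'), ⟨f.trans g⟩⟩
  · by_cases hi : i = 0
    · subst hi
      obtain ⟨r, ⟨g⟩⟩ := hzero j
      -- For `i = 0` addition is commutative, so passing to the opposite gives nothing new.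
      exact ⟨r, ⟨(f.opOfOp.trans (RingEquiv.opOfAddComm Model.add_comm_of_eq_zero).symm).trans g⟩⟩
    · obtain ⟨j', ⟨g⟩⟩ := hone i j hi
      exact ⟨.inr (true, j'), ⟨(f.trans g).opOfOp⟩⟩

theorem eq_of_rep_equiv (hpq : p ≡ 1 [MOD q]) (he : Function.Injective e)
    {r r' : Bool ⊕ (Bool × ZMod q)}
    (f : (rep.{u} e r).carrier ≃+* (rep.{u} e r').carrier) : r = r' := by
  have hadd : (r.isLeft : Prop) ↔ r'.isLeft := by
    rw [← rep_add_comm_iff.{u} he, ← rep_add_comm_iff.{u} he]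
    exact (AddEquiv.toMultiplicative f.toAddEquiv).mul_comm_iff
  have hmul : mulParam r = 0 ↔ mulParam r' = 0 := by
    rw [← rep_mul_comm_iff.{u} he, ← rep_mul_comm_iff.{u} he]
    exact f.toMulEquiv.mul_comm_iff
  match r, r' with
  | .inl false, .inl false => rfl
  | .inl true, .inl true => rfl
  | .inl true, .inl false => simp [mulParam] at hmul
  | .inl false, .inl true => simp [mulParam] at hmul
  | .inl _, .inr _ => simp at hadd
  | .inr _, .inl _ => simp at hadd
  | .inr (false, j), .inr (false, j') => rw [Model.eq_of_equiv hpq he f]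
  | .inr (true, j), .inr (true, j') =>
    rw [Model.eq_of_equiv hpq he (RingEquiv.ofOpOp f)]
  | .inr (false, j), .inr (true, j') => exact (Model.not_equiv_op hpq he f).elim
  | .inr (true, j), .inr (false, j') => exact (Model.not_equiv_op hpq he f.symm).elim

end BundledSkewBrace

/-! ### Counting the representatives. -/

namespace BundledSkewBrace

open SkewBrace

variable {p q : ℕ} [Fact p.Prime] [Fact q.Prime] {e : AddChar (ZMod q) (ZMod p)}

theorem numIsoTypes_eq_ncard (hpq : p ≡ 1 [MOD q]) (he : Function.Injective e)
    {P : BundledSkewBrace.{u} → Prop} (hcard : ∀ B, P B → Nat.card B.carrier = p * q)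
    (hiso : ∀ B B' : BundledSkewBrace.{u}, (B.carrier ≃+* B'.carrier) → P B → P B') :
    numIsoTypes P = Set.ncard {r | P (rep e r)} := by
  rw [numIsoTypes, ← Set.ncard_image_of_injective {r | P (rep e r)}
    (f := fun r => (Quotient.mk isoSetoid.{u} (rep e r))) (fun r r' h => by
      obtain ⟨f⟩ := Quotient.exact h
      exact eq_of_rep_equiv hpq he f)]
  congr 1
  ext c
  constructor
  · rintro ⟨B, hB, rfl⟩
    obtain ⟨r, ⟨f⟩⟩ := exists_equiv_rep hpq he B (hcard B hB)
    exact ⟨r, hiso _ _ f hB, Quotient.sound ⟨f.symm⟩⟩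
  · rintro ⟨r, hr, rfl⟩
    exact ⟨_, hr, rfl⟩

theorem numOfOrder_eq (hpq : p ≡ 1 [MOD q]) : numOfOrder.{u} (p * q) = 2 * q + 2 := by
  obtain ⟨e, he⟩ := exists_injective_addChar (p := p) (q := q) hpq
  rw [numOfOrder, numIsoTypes_eq_ncard hpq he (fun B hB => hB)
    (fun B B' f hB => (Nat.card_congr f.toEquiv).symm.trans hB)]
  simp only [card_rep, Set.ofPred_true, Set.ncard_univ, Nat.card_sum, Nat.card_prod, Nat.card_zmod,
    Nat.card_eq_fintype_card (α := Bool), Fintype.card_bool]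
  ring

/-- The propositions `m` and `a` stand for commutativity of `M` and `A`, so all four table entries
come from one count. -/
theorem b_eq_ncard (hpq : p ≡ 1 [MOD q]) (he : Function.Injective e) {M A : Type u} [Group M]
    [Group A] (hM : Nat.card M = p * q) {m a : Prop}
    (hMm : ∀ (G : Type u) [Group G], Nat.card G = p * q →
      (Nonempty (G ≃* M) ↔ (m ↔ ∀ x y : G, x * y = y * x)))
    (hAa : ∀ (G : Type u) [Group G], Nat.card G = p * q →
      (Nonempty (G ≃* A) ↔ (a ↔ ∀ x y : G, x * y = y * x))) :
    b M A = Set.ncard {r : Bool ⊕ (Bool × ZMod q) | (m ↔ mulParam r = 0) ∧ (a ↔ r.isLeft)} := by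
  rw [b, numIsoTypes_eq_ncard hpq he]
  · congr 1
    ext r
    simp only [Set.mem_ofPred_eq]
    rw [hMm _ (card_rep e r), hAa _ ((Nat.card_multiplicative _).trans (card_rep e r)),
      rep_mul_comm_iff he, ← rep_add_comm_iff.{u} he]
    rfl
  · rintro B ⟨⟨f⟩, -⟩
    rw [Nat.card_congr f.toEquiv, hM]
  · rintro B B' f ⟨⟨g⟩, ⟨h⟩⟩
    exact ⟨⟨f.symm.toMulEquiv.trans g⟩, ⟨(AddEquiv.toMultiplicative f.symm.toAddEquiv).trans h⟩⟩

theorem ncard_rep_mul_comm_add_comm :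
    Set.ncard {r : Bool ⊕ (Bool × ZMod q) | (True ↔ mulParam r = 0) ∧ (True ↔ r.isLeft)} = 1 := by
  rw [Set.ncard_eq_one]
  refine ⟨.inl false, ?_⟩
  ext r
  rcases r with (_ | _) | ⟨s, j⟩ <;> simp [mulParam]

theorem ncard_rep_not_mul_comm_add_comm :
    Set.ncard {r : Bool ⊕ (Bool × ZMod q) | (False ↔ mulParam r = 0) ∧ (True ↔ r.isLeft)} = 1 := by
  rw [Set.ncard_eq_one]
  refine ⟨.inl true, ?_⟩
  ext r
  rcases r with (_ | _) | ⟨s, j⟩ <;> simp [mulParam]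

theorem ncard_rep_mul_comm_not_add_comm :
    Set.ncard {r : Bool ⊕ (Bool × ZMod q) | (True ↔ mulParam r = 0) ∧ (False ↔ r.isLeft)} = 2 := by
  rw [Set.ncard_eq_two]
  refine ⟨.inr (false, 0), .inr (true, 0), by simp, ?_⟩
  ext r
  rcases r with (_ | _) | ⟨_ | _, j⟩ <;> simp [mulParam]

theorem ncard_rep_not_mul_comm_not_add_comm :
    Set.ncard {r : Bool ⊕ (Bool × ZMod q) | (False ↔ mulParam r = 0) ∧ (False ↔ r.isLeft)} =
      2 * (q - 1) := by
  have h : {r : Bool ⊕ (Bool × ZMod q) | (False ↔ mulParam r = 0) ∧ (False ↔ r.isLeft)} =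
      Sum.inr '' (Set.univ ×ˢ {0}ᶜ) := by
    ext r
    rcases r with (_ | _) | ⟨s, j⟩ <;> simp [mulParam]
  rw [h, Set.ncard_image_of_injective _ Sum.inr_injective, Set.ncard_prod, Set.ncard_univ,
    Set.ncard_compl, Set.ncard_singleton, Nat.card_zmod, Nat.card_eq_fintype_card,
    Fintype.card_bool]

end BundledSkewBrace

theorem mainTheorem3 (p q : ℕ) (hp : p.Prime) (hq : q.Prime) (hpq : p ≡ 1 [MOD q]) :
    -- a nontrivial action of `C_q` on `C_p` exists
    (∃ φ : Cyc q →* MulAut (Cyc p), φ ≠ 1) ∧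
    -- for any such action, `C_pq` and `C_p ⋊ C_q` are the two groups of order `pq` up to
    -- isomorphism, and `b(M, A)` has the tabulated values
    (∀ φ : Cyc q →* MulAut (Cyc p), φ ≠ 1 →
      (∀ (G : Type u) [Group G], Nat.card G = p * q →
        Xor (Nonempty (G ≃* Cyc (p * q))) (Nonempty (G ≃* Cyc p ⋊[φ] Cyc q))) ∧
      (∀ (M A : Type u) [Group M] [Group A],
        (Nonempty (M ≃* Cyc (p * q)) → Nonempty (A ≃* Cyc (p * q)) →
          BundledSkewBrace.b M A = 1) ∧
        (Nonempty (M ≃* Cyc (p * q)) → Nonempty (A ≃* Cyc p ⋊[φ] Cyc q) →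
          BundledSkewBrace.b M A = 2) ∧
        (Nonempty (M ≃* Cyc p ⋊[φ] Cyc q) → Nonempty (A ≃* Cyc (p * q)) →
          BundledSkewBrace.b M A = 1) ∧
        (Nonempty (M ≃* Cyc p ⋊[φ] Cyc q) → Nonempty (A ≃* Cyc p ⋊[φ] Cyc q) →
          BundledSkewBrace.b M A = 2 * (q - 1)))) ∧
    -- the total number of skew braces of order `pq`
    BundledSkewBrace.numOfOrder.{u} (p * q) = 2 * q + 2 := by
  have : Fact p.Prime := ⟨hp⟩
  have : Fact q.Prime := ⟨hq⟩
  obtain ⟨e, he⟩ := exists_injective_addChar (p := p) (q := q) hpq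
  refine ⟨⟨_, AddChar.toAction_ne_one he⟩, fun φ hφ => ⟨fun G _ hG => ?_, fun M A _ _ => ?_⟩,
    BundledSkewBrace.numOfOrder_eq hpq⟩
  · rw [nonempty_mulEquiv_cyc_iff hpq hG, nonempty_mulEquiv_semidirectProduct_iff hpq hφ hG]
    by_cases h : ∀ a b : G, a * b = b * a
    · exact Or.inl ⟨h, fun h' => h' h⟩
    · exact Or.inr ⟨h, h⟩
  · have hcyc : ∀ {N : Type u} [Group N], Nonempty (N ≃* Cyc (p * q)) →
        Nat.card N = p * q ∧ ∀ (G : Type u) [Group G], Nat.card G = p * q →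
          (Nonempty (G ≃* N) ↔ (True ↔ ∀ x y : G, x * y = y * x)) := by
      rintro N _ ⟨f⟩
      refine ⟨?_, fun G _ hG => ?_⟩
      · rw [Nat.card_congr f.toEquiv, Nat.card_multiplicative, Nat.card_zmod]
      · rw [true_iff, ← nonempty_mulEquiv_cyc_iff hpq hG]
        exact ⟨fun ⟨g⟩ => ⟨g.trans f⟩, fun ⟨g⟩ => ⟨g.trans f.symm⟩⟩
    have hsemi : ∀ {N : Type u} [Group N], Nonempty (N ≃* Cyc p ⋊[φ] Cyc q) →
        Nat.card N = p * q ∧ ∀ (G : Type u) [Group G], Nat.card G = p * q →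
          (Nonempty (G ≃* N) ↔ (False ↔ ∀ x y : G, x * y = y * x)) := by
      rintro N _ ⟨f⟩
      refine ⟨?_, fun G _ hG => ?_⟩
      · rw [Nat.card_congr f.toEquiv, SemidirectProduct.card, Nat.card_multiplicative,
          Nat.card_multiplicative, Nat.card_zmod, Nat.card_zmod]
      · rw [false_iff, ← nonempty_mulEquiv_semidirectProduct_iff hpq hφ hG]
        exact ⟨fun ⟨g⟩ => ⟨g.trans f⟩, fun ⟨g⟩ => ⟨g.trans f.symm⟩⟩
    refine ⟨fun hM hA => ?_, fun hM hA => ?_, fun hM hA => ?_, fun hM hA => ?_⟩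
    · rw [BundledSkewBrace.b_eq_ncard hpq he (hcyc hM).1 (hcyc hM).2 (hcyc hA).2,
        BundledSkewBrace.ncard_rep_mul_comm_add_comm]
    · rw [BundledSkewBrace.b_eq_ncard hpq he (hcyc hM).1 (hcyc hM).2 (hsemi hA).2,
        BundledSkewBrace.ncard_rep_mul_comm_not_add_comm]
    · rw [BundledSkewBrace.b_eq_ncard hpq he (hsemi hM).1 (hsemi hM).2 (hcyc hA).2,
        BundledSkewBrace.ncard_rep_not_mul_comm_add_comm]
    · rw [BundledSkewBrace.b_eq_ncard hpq he (hsemi hM).1 (hsemi hM).2 (hsemi hA).2,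
        BundledSkewBrace.ncard_rep_not_mul_comm_not_add_comm]
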